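/- Let $\mathbb K=\mathbb R$ or $\mathbb C$ and let $(X,\tau)$ be a bornological locally convex Hausdorff space over $\mathbb K$. Suppose that $\widetilde\tau$ is a locally convex Hausdorff topology on $X$ such that * (BBCl) every $\tau$-bounded subset of $X$ is contained in an absolutely convex, $\tau$-bounded, $\widetilde\tau$-closed set, and * (CNC) $\tau$ has a $0$-neighbourhood basis consisting of absolutely convex $\widetilde\tau$-closed sets. Let $\widetilde\gamma$ denote the finest locally convex Hausdorff topology on $X$ which coincides with $\widetilde\tau$ on every $\tau$-bounded set. For a locally convex Hausdorff space $E$ let $E_b'$ denote its topological dual with the topology of uniform convergence on the bounded subsets of $E$; $E$ is called semi-reflexive if the canonical map $E\to (E_b')'$, $x\mapsto[x'\mapsto x'(x)]$, is surjective. Assume that $(X,\widetilde\gamma)$ is semi-reflexive and that * (B$\tau$B$\widetilde\gamma$) a subset of $X$ is $\tau$-bounded if and only if it is $\widetilde\gamma$-bounded. Then $(X,\widetilde\gamma)_b'$ is a complete barrelled locally convex Hausdorff space, and the evaluation map $$\mathcal I\colon (X,\tau)\to ((X,\widetilde\gamma)_b')_b',\qquad x\longmapsto [x'\mapsto x'(x)],$$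 is a well-defined topological isomorphism. In particular, $(X,\tau)$ is a bidual space with semi-reflexive prebidual $((X,\widetilde\gamma),\mathcal I)$; that is, $(X,\widetilde\gamma)$ is a semi-reflexive locally convex Hausdorff space and $\mathcal I$ is a topological isomorphism of $(X,\tau)$ onto its strong bidual. -/

import Mathlib

open Set Topology

namespace MixedDual

/-- The set `X` regarded as a topological space with topology `t`. -/
def SpaceWith (X : Type*) (_t : TopologicalSpace X) : Type _ := X

section SpaceWith

variable {X : Type*} (t : TopologicalSpace X)

instance : TopologicalSpace (SpaceWith X t) := t

instance [AddCommGroup X] : AddCommGroup (SpaceWith X t) := inferInstanceAs (AddCommGroup X)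

instance {R : Type*} [Semiring R] [AddCommGroup X] [Module R X] : Module R (SpaceWith X t) :=
  inferInstanceAs (Module R X)

end SpaceWith

section Topologies

variable (𝕜 : Type*) [RCLike 𝕜] {X : Type*} [AddCommGroup X] [Module 𝕜 X] [Module ℝ X]

/-- `t` is a locally convex Hausdorff (vector space) topology on `X`. -/
structure IsLCH (t : TopologicalSpace X) : Prop where
  isTopologicalAddGroup : @IsTopologicalAddGroup X t _
  continuousSMul : @ContinuousSMul 𝕜 X _ _ t
  locallyConvexSpace : @LocallyConvexSpace ℝ X _ _ _ _ t
  t2Space : @T2Space X t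

/-- `B` is a bounded subset of `(X, t)`. -/
def IsBdd (t : TopologicalSpace X) (B : Set X) : Prop :=
  @Bornology.IsVonNBounded 𝕜 X _ _ _ t B

/-- `U` is absolutely convex. -/
def IsAbsConvex (U : Set X) : Prop := Balanced 𝕜 U ∧ Convex ℝ U

/-- `(X, t)` is bornological: every absolutely convex set absorbing all bounded sets is a
`0`-neighbourhood. -/
def IsBornological (t : TopologicalSpace X) : Prop :=
  ∀ U : Set X, IsAbsConvex 𝕜 U → (∀ B : Set X, IsBdd 𝕜 t B → Absorbs 𝕜 U B) →
    U ∈ @nhds X t 0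

/-- Condition (BBCl) of `(X, τ)` for `τ'`. -/
def BBCl (τ τ' : TopologicalSpace X) : Prop :=
  ∀ B : Set X, IsBdd 𝕜 τ B →
    ∃ C : Set X, B ⊆ C ∧ IsAbsConvex 𝕜 C ∧ IsBdd 𝕜 τ C ∧ IsClosed[τ'] C

/-- Condition (CNC) of `(X, τ)` for `τ'`. -/
def CNC (τ τ' : TopologicalSpace X) : Prop :=
  (@nhds X τ 0).HasBasis
    (fun U : Set X => U ∈ @nhds X τ 0 ∧ IsAbsConvex 𝕜 U ∧ IsClosed[τ'] U) id

/-- The topology `γ` coincides with `τ'` on every `τ`-bounded set. -/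
def AgreeOnBdd (τ τ' γ : TopologicalSpace X) : Prop :=
  ∀ B : Set X, IsBdd 𝕜 τ B →
    TopologicalSpace.induced (Subtype.val : B → X) γ =
      TopologicalSpace.induced (Subtype.val : B → X) τ'

/-- The finest locally convex Hausdorff topology on `X` which coincides with `τ'` on `τ`-bounded
sets (in Mathlib's order on topologies, finer means smaller; see `isLeast_gammaTilde`). -/
def gammaTilde (τ τ' : TopologicalSpace X) : TopologicalSpace X :=
  sInf {γ | IsLCH 𝕜 γ ∧ AgreeOnBdd 𝕜 τ τ' γ}

/-- The topologies `τ` and `γ` have the same bounded sets. -/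
def SameBdd (τ γ : TopologicalSpace X) : Prop :=
  ∀ B : Set X, IsBdd 𝕜 τ B ↔ IsBdd 𝕜 γ B

theorem isLeast_gammaTilde (τ τ' : TopologicalSpace X) (h' : IsLCH 𝕜 τ') :
    IsLeast {γ | IsLCH 𝕜 γ ∧ AgreeOnBdd 𝕜 τ τ' γ} (gammaTilde 𝕜 τ τ') := by
  have hmem : τ' ∈ {γ | IsLCH 𝕜 γ ∧ AgreeOnBdd 𝕜 τ τ' γ} := ⟨h', fun _ _ => rfl⟩
  refine ⟨⟨⟨?_, ?_, ?_, ?_⟩, ?_⟩, fun γ hγ => sInf_le hγ⟩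
  · exact topologicalAddGroup_sInf fun γ hγ => hγ.1.1
  · exact continuousSMul_sInf fun γ hγ => hγ.1.2
  · exact LocallyConvexSpace.sInf fun γ hγ => hγ.1.3
  · exact @T2Space.of_injective_continuous X X (gammaTilde 𝕜 τ τ') τ' h'.4 id
      Function.injective_id (continuous_id_iff_le.2 (sInf_le hmem))
  · intro B hB
    rw [gammaTilde, sInf_eq_iInf, induced_iInf]
    refine le_antisymm ?_ ?_
    · refine (iInf_le _ τ').trans ?_
      rw [induced_iInf]
      exact iInf_le _ hmem
    · refine le_iInf fun γ => ?_
      rw [induced_iInf]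
      exact le_iInf fun hγ => (hγ.2 B hB).ge

instance (τ τ' : TopologicalSpace X) :
    ContinuousSMul 𝕜 (SpaceWith X (gammaTilde 𝕜 τ τ')) :=
  continuousSMul_sInf (M := 𝕜) (X := X) fun _ hγ => hγ.1.2

end Topologies

section Duals

/-! `StrongDual 𝕜 E` is Mathlib's continuous dual with the topology of uniform convergence on the
(von Neumann) bounded subsets of `E`. -/

variable (𝕜 : Type*) [RCLike 𝕜] (E : Type*) [AddCommGroup E] [Module 𝕜 E] [TopologicalSpace E]
  [ContinuousSMul 𝕜 E]

/-- The canonical map `x ↦ [f ↦ f x]` from `E` to its strong bidual. -/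
def evalBidual : E →ₗ[𝕜] StrongDual 𝕜 (StrongDual 𝕜 E) where
  toFun x :=
    { toFun := fun f => f x
      map_add' := fun _ _ => rfl
      map_smul' := fun _ _ => rfl
      cont := continuous_eval_const x }
  map_add' x y := by ext f; exact map_add f x y
  map_smul' c x := by ext f; exact map_smul f c x

/-- `E` is semi-reflexive. -/
def IsSemiReflexive : Prop := Function.Surjective (evalBidual 𝕜 E)

end Duals

section Prebidual

variable (𝕜 : Type*) [RCLike 𝕜] {X : Type*} [AddCommGroup X] [Module 𝕜 X] [Module ℝ X]

/-- `(Y, υ)` together with the linear map `φ` is a prebidual of `(X, τ)`: `(Y, υ)` is a locally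
convex Hausdorff space and `φ` is a topological isomorphism from `(X, τ)` onto the strong bidual
of `(Y, υ)`. -/
structure IsPrebidual (τ : TopologicalSpace X)
    {Y : Type*} [AddCommGroup Y] [Module 𝕜 Y] [Module ℝ Y] (υ : TopologicalSpace Y)
    (φ : SpaceWith X τ →ₗ[𝕜] StrongDual 𝕜 (StrongDual 𝕜 (SpaceWith Y υ))) : Prop where
  isLCH : IsLCH 𝕜 υ
  isHomeomorph : IsHomeomorph φ

/-- The evaluation map `x ↦ [f ↦ f x]` from `(X, τ)` to the strong bidual of
`(X, gammaTilde 𝕜 τ τ')`. -/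
def evalMixed (τ τ' : TopologicalSpace X) :
    SpaceWith X τ →ₗ[𝕜] StrongDual 𝕜 (StrongDual 𝕜 (SpaceWith X (gammaTilde 𝕜 τ τ'))) where
  toFun x := evalBidual 𝕜 (SpaceWith X (gammaTilde 𝕜 τ τ')) x
  map_add' := map_add (evalBidual 𝕜 (SpaceWith X (gammaTilde 𝕜 τ τ')))
  map_smul' := map_smul (evalBidual 𝕜 (SpaceWith X (gammaTilde 𝕜 τ τ')))

end Prebidual

end MixedDual

/-!
Everything is read off from polars. By Mackey's theorem the polar in `E` of an absorbent set of
functionals is bounded; in the strong dual of a semi-reflexive space every barrel is, by the bipolar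
theorem, the polar of such a bounded set, hence a neighbourhood of zero. A uniform limit on bounded
sets of continuous functionals is continuous on bounded sets, and because `γ̃` is the finest
topology agreeing with `τ̃` on the bounded sets, such a limit is `γ̃`-continuous: the dual is
complete.

For the evaluation map, the polar of a strongly bounded set of functionals absorbs every bounded
set, so it is a `τ`-neighbourhood of zero because `τ` is bornological. Conversely, a
`τ`-neighbourhood `U` as in (CNC) equals its bipolar, and the polar of `U` is strongly bounded
because `U` absorbs bounded sets; so the image of `U` contains the polar of a bounded set.
-/

namespace MixedDual

open Bornology Filter
open scoped Pointwise

section Polar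

theorem absorbs_polar_iff {𝕜 E F : Type*} [NontriviallyNormedField 𝕜] [AddCommGroup E]
    [AddCommGroup F] [Module 𝕜 E] [Module 𝕜 F] {B : E →ₗ[𝕜] F →ₗ[𝕜] 𝕜} {s : Set E} {t : Set F} :
    Absorbs 𝕜 (B.polar s) t ↔ IsBounded (image2 (fun x y => B x y) s t) := by
  rw [absorbs_iff_norm, isBounded_iff_forall_norm_le]
  constructor
  · rintro ⟨r, hr⟩
    obtain ⟨c, hc⟩ := NormedField.exists_lt_norm 𝕜 r
    refine ⟨‖c‖, forall_mem_image2.2 fun x hx y hy => ?_⟩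
    obtain ⟨z, hz, rfl⟩ := hr c hc.le hy
    simpa only [map_smul, norm_smul] using mul_le_of_le_one_right (norm_nonneg c) (hz x hx)
  · rintro ⟨r, hr⟩
    refine ⟨max r 1, fun c hc y hy => ?_⟩
    have hc0 : 0 < ‖c‖ := one_pos.trans_le ((le_max_right r 1).trans hc)
    rw [mem_smul_set_iff_inv_smul_mem₀ (norm_pos_iff.1 hc0)]
    intro x hx
    rw [map_smul, norm_smul, norm_inv, inv_mul_le_one₀ hc0]
    exact (hr _ (mem_image2_of_mem hx hy)).trans ((le_max_left r 1).trans hc)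

open ComplexOrder in
theorem isAbsConvex_polar {𝕜 E F : Type*} [RCLike 𝕜] [AddCommGroup E] [AddCommGroup F]
    [Module 𝕜 E] [Module 𝕜 F] [Module ℝ F] [IsScalarTower ℝ 𝕜 F] (B : E →ₗ[𝕜] F →ₗ[𝕜] 𝕜)
    (s : Set E) : IsAbsConvex 𝕜 (B.polar s) :=
  have h : AbsConvex 𝕜 (B.polar s) := LinearMap.polar_AbsConvex s
  ⟨h.1, convex_RCLike_iff_convex_real.1 h.2⟩

end Polar

section LocallyConvex

theorem bddAbove_seminorm_image {𝕜 E : Type*} [RCLike 𝕜] [AddCommGroup E] [Module 𝕜 E]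
    {p : Seminorm 𝕜 E} {A : Set E}
    (hA : ∀ g : E →ₗ[𝕜] 𝕜, (∃ C, ∀ x, ‖g x‖ ≤ C * p x) → IsBounded (g '' A)) :
    BddAbove (p '' A) := by
  let : SeminormedAddCommGroup E := p.toAddGroupSeminorm.toSeminormedAddCommGroup
  let : NormedSpace 𝕜 E := ⟨fun c x => (map_smul_eq_mul p c x).le⟩
  have hpointwise (f : StrongDual 𝕜 E) :
      ∃ C, ∀ x : A, ‖NormedSpace.inclusionInDoubleDual 𝕜 E x f‖ ≤ C := by
    obtain ⟨C, hC⟩ := isBounded_iff_forall_norm_le.1 (hA f ⟨‖f‖, f.le_opNorm⟩)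
    exact ⟨C, fun x => hC _ (mem_image_of_mem f x.2)⟩
  obtain ⟨C, hC⟩ := banach_steinhaus hpointwise
  refine ⟨C, forall_mem_image.2 fun x hx => ?_⟩
  exact ((NormedSpace.inclusionInDoubleDualLi (E := E) 𝕜).norm_map x).ge.trans (hC ⟨x, hx⟩)

variable {𝕜 E : Type*} [RCLike 𝕜] [AddCommGroup E] [Module 𝕜 E] [Module ℝ E] [IsScalarTower ℝ 𝕜 E]
  [TopologicalSpace E] [IsTopologicalAddGroup E] [ContinuousSMul 𝕜 E] [LocallyConvexSpace ℝ E]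

open ComplexOrder in
theorem isVonNBounded_of_forall_strongDual {A : Set E}
    (hA : ∀ f : StrongDual 𝕜 E, IsBounded (f '' A)) : IsVonNBounded 𝕜 A := by
  have : ContinuousSMul ℝ E := IsScalarTower.continuousSMul 𝕜
  have : LocallyConvexSpace 𝕜 E := .ofBasisZero 𝕜 E _ _
    (LocallyConvexSpace.convex_basis_zero ℝ E) fun _ hs => convex_RCLike_iff_convex_real.2 hs.2
  rw [(PolynormableSpace.withSeminorms 𝕜 E).isVonNBounded_iff_seminorm_bddAbove]
  rintro ⟨p, hp⟩
  refine bddAbove_seminorm_image ?_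
  rintro g ⟨C, hC⟩
  have hg : Tendsto g (𝓝 0) (𝓝 0) := squeeze_zero_norm hC <| by
    simpa using (hp.tendsto 0).const_mul C
  exact hA ⟨g, continuous_of_tendsto_nhds_zero g hg⟩

theorem isVonNBounded_polar_of_absorbent {s : Set (StrongDual 𝕜 E)} (hs : Absorbent 𝕜 s) :
    IsVonNBounded 𝕜 ((topDualPairing 𝕜 E).polar s) := by
  refine isVonNBounded_of_forall_strongDual fun f => ?_
  have habs : Absorbs 𝕜 (StrongDual.polar 𝕜 ((topDualPairing 𝕜 E).polar s)) {f} :=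
    (hs f).mono_left ((topDualPairing 𝕜 E).subset_bipolar s)
  simpa [image2_singleton_right] using absorbs_polar_iff.1 habs

variable (𝕜) in
theorem polar_polar_eq_self {C : Set E} (hC : IsAbsConvex 𝕜 C) (hcl : IsClosed C)
    (hne : C.Nonempty) : (topDualPairing 𝕜 E).polar (StrongDual.polar 𝕜 C) = C := by
  refine Subset.antisymm (fun x hx => ?_) ((topDualPairing 𝕜 E).flip.subset_bipolar C)
  by_contra hxC
  obtain ⟨f, u, hfC, hux⟩ := RCLike.geometric_hahn_banach_closed_point (𝕜 := 𝕜) hC.2 hcl hxC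
  have hu : 0 < u := by simpa using hfC 0 (hC.1.zero_mem hne)
  have hnorm : ∀ y ∈ C, ‖f y‖ ≤ u := by
    intro y hy
    obtain ⟨d, hd, hdy⟩ := RCLike.exists_norm_eq_mul_self (f y)
    have := hfC (d • y) (hC.1 d hd.le (smul_mem_smul_set hy))
    rw [map_smul, smul_eq_mul, ← hdy, RCLike.ofReal_re] at this
    exact this.le
  have hscale (y : E) : ‖(((u⁻¹ : ℝ) : 𝕜) • f) y‖ = ‖f y‖ / u := by
    rw [_root_.smul_apply, norm_smul, RCLike.norm_ofReal, abs_of_pos (inv_pos.2 hu),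
      inv_mul_eq_div]
  have hfx : ‖f x‖ / u ≤ 1 := hscale x ▸ hx (((u⁻¹ : ℝ) : 𝕜) • f) fun y hy =>
    (hscale y).trans_le ((div_le_one hu).2 (hnorm y hy))
  exact (hux.trans_le (RCLike.re_le_norm (f x))).not_ge ((div_le_one hu).1 hfx)

theorem evalBidual_injective [T2Space E] : Function.Injective (evalBidual 𝕜 E) := by
  intro x y hxy
  by_contra hne
  obtain ⟨f, hf⟩ := RCLike.geometric_hahn_banach_point_point (𝕜 := 𝕜) hne
  exact hf.ne (congrArg RCLike.re (DFunLike.congr_fun hxy f))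

end LocallyConvex

section StrongDual

variable {𝕜 E : Type*} [RCLike 𝕜] [AddCommGroup E] [Module 𝕜 E] [TopologicalSpace E]

theorem hasBasis_nhds_zero_polar [ContinuousSMul 𝕜 E] :
    (𝓝 (0 : StrongDual 𝕜 E)).HasBasis (IsVonNBounded 𝕜) (StrongDual.polar 𝕜) := by
  refine (ContinuousLinearMap.hasBasis_nhds_zero_of_basis Metric.nhds_basis_closedBall).to_hasBasis
    ?_ fun B hB => ⟨(B, 1), ⟨hB, one_pos⟩, fun f hf x hx => mem_closedBall_zero_iff.1 (hf x hx)⟩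
  rintro ⟨B, ε⟩ ⟨hB, hε : 0 < ε⟩
  obtain ⟨c, hc⟩ := NormedField.exists_lt_norm 𝕜 (1 / ε)
  have hc0 : 0 < ‖c‖ := (one_div_pos.2 hε).trans hc
  refine ⟨c • B, hB.image (c • ContinuousLinearMap.id 𝕜 E), fun f hf x hx => ?_⟩
  have hfx : ‖c‖ * ‖f x‖ ≤ 1 := by simpa using hf (c • x) (smul_mem_smul_set hx)
  rw [mem_closedBall_zero_iff]
  calc ‖f x‖ ≤ 1 / ‖c‖ := (le_div_iff₀' hc0).2 hfx
    _ ≤ ε := (one_div_le hc0 hε).2 hc.le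

theorem isVonNBounded_strongDual_polar {U : Set E}
    (hU : ∀ B, IsVonNBounded 𝕜 B → Absorbs 𝕜 U B) : IsVonNBounded 𝕜 (StrongDual.polar 𝕜 U) := by
  refine ContinuousLinearMap.isVonNBounded_iff.2 fun B hB => ?_
  have habs : Absorbs 𝕜 ((topDualPairing 𝕜 E).polar (StrongDual.polar 𝕜 U)) B :=
    (hU B hB).mono_left ((topDualPairing 𝕜 E).flip.subset_bipolar U)
  exact (NormedSpace.isVonNBounded_iff 𝕜).2 (absorbs_polar_iff.1 habs)

theorem absorbs_polar_of_isVonNBounded {H : Set (StrongDual 𝕜 E)} (hH : IsVonNBounded 𝕜 H)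
    {B : Set E} (hB : IsVonNBounded 𝕜 B) : Absorbs 𝕜 ((topDualPairing 𝕜 E).polar H) B :=
  absorbs_polar_iff.2 <| (NormedSpace.isVonNBounded_iff 𝕜).1 <|
    ContinuousLinearMap.isVonNBounded_image2_apply hH hB

end StrongDual

section SemiReflexive

variable {𝕜 E : Type*} [RCLike 𝕜] [AddCommGroup E] [Module 𝕜 E]
  [TopologicalSpace E] [ContinuousSMul 𝕜 E]

theorem IsSemiReflexive.polar_polar_eq_self (h : IsSemiReflexive 𝕜 E) {s : Set (StrongDual 𝕜 E)}
    (hs : IsAbsConvex 𝕜 s) (hcl : IsClosed s) (hne : s.Nonempty) :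
    StrongDual.polar 𝕜 ((topDualPairing 𝕜 E).polar s) = s := by
  refine Subset.antisymm ?_ ((topDualPairing 𝕜 E).subset_bipolar s)
  conv_rhs => rw [← MixedDual.polar_polar_eq_self 𝕜 hs hcl hne]
  intro f hf φ hφ
  obtain ⟨x, rfl⟩ := h φ
  exact hf x hφ

theorem IsSemiReflexive.barrelledSpace_strongDual [Module ℝ E] [IsScalarTower ℝ 𝕜 E]
    [IsTopologicalAddGroup E] [LocallyConvexSpace ℝ E] (h : IsSemiReflexive 𝕜 E) :
    BarrelledSpace 𝕜 (StrongDual 𝕜 E) where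
  continuous_of_lowerSemicontinuous p hp := by
    have hclosed : IsClosed (p.closedBall 0 1) := by
      rw [Seminorm.closedBall_zero_eq]
      exact hp.isClosed_preimage 1
    have hbipolar := h.polar_polar_eq_self
      ⟨p.balanced_closedBall_zero 1, p.convex_closedBall 0 1⟩ hclosed ⟨0, by simp⟩
    refine Seminorm.continuous' (r := 1) (hbipolar ▸ hasBasis_nhds_zero_polar.mem_of_mem ?_)
    exact isVonNBounded_polar_of_absorbent (p.absorbent_closedBall_zero one_pos)

end SemiReflexive

section Complete

theorem isClosed_setOf_forall_continuousOn {α β : Type*} [TopologicalSpace α] [UniformSpace β]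
    (𝔖 : Set (Set α)) :
    IsClosed {f : UniformOnFun α β 𝔖 | ∀ s ∈ 𝔖, ContinuousOn (UniformOnFun.toFun 𝔖 f) s} := by
  refine isClosed_iff_forall_filter.2 fun f u _ hu huf s hs => ?_
  rw [← tendsto_id', UniformOnFun.tendsto_iff_tendstoUniformlyOn] at huf
  exact (huf s hs).continuousOn <| Eventually.frequently <| hu fun _ hg => hg s hs

theorem completeSpace_uniformConvergenceCLM {𝕜₁ 𝕜₂ E F : Type*} [NormedField 𝕜₁]
    [NormedField 𝕜₂] {σ : 𝕜₁ →+* 𝕜₂} [AddCommGroup E] [Module 𝕜₁ E] [TopologicalSpace E]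
    [AddCommGroup F] [Module 𝕜₂ F] [UniformSpace F] [IsUniformAddGroup F]
    [ContinuousConstSMul 𝕜₂ F] [T2Space F] [CompleteSpace F] {𝔖 : Set (Set E)}
    (hcover : ⋃₀ 𝔖 = univ)
    (h : ∀ g : E →ₛₗ[σ] F, (∀ s ∈ 𝔖, ContinuousOn g s) → Continuous g) :
    CompleteSpace (UniformConvergenceCLM σ F 𝔖) := by
  rw [completeSpace_iff_isComplete_range (UniformConvergenceCLM.isUniformInducing_coeFn σ F 𝔖)]
  have hlinear := (LinearMap.isClosed_range_coe E F σ).preimage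
    (UniformOnFun.uniformContinuous_toFun hcover).continuous
  refine IsClosed.isComplete ?_
  convert! (isClosed_setOf_forall_continuousOn 𝔖).inter hlinear
  refine Subset.antisymm ?_ ?_
  · rintro _ ⟨g, rfl⟩
    exact ⟨fun s _ => (map_continuous g).continuousOn, ⟨g.toLinearMap, rfl⟩⟩
  · rintro f ⟨hf, g, hg⟩
    exact ⟨⟨g, h g fun s hs => hg ▸ hf s hs⟩, hg⟩

end Complete

section SecondTopology

variable {𝕜 E : Type*} [RCLike 𝕜] [AddCommGroup E] [Module 𝕜 E] [Module ℝ E] [IsScalarTower ℝ 𝕜 E]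
  {τ : TopologicalSpace E} [γ : TopologicalSpace E] [ContinuousSMul 𝕜 E]

theorem continuous_evalBidual_of_isBornological (hτ : @IsTopologicalAddGroup E τ _)
    (hborn : IsBornological 𝕜 τ) (hbdd : ∀ B, IsBdd 𝕜 τ B → IsBdd 𝕜 γ B) :
    Continuous[τ, _] (evalBidual 𝕜 E) := by
  have : ContinuousAdd (StrongDual 𝕜 (StrongDual 𝕜 E)) :=
    (inferInstance : IsTopologicalAddGroup (StrongDual 𝕜 (StrongDual 𝕜 E))).toContinuousAdd
  refine @continuous_of_tendsto_nhds_zero E τ _ hτ _ _ _ _ _ _ _ (evalBidual 𝕜 E) ?_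
  refine hasBasis_nhds_zero_polar.tendsto_right_iff.2 fun H hH => ?_
  exact hborn _ (isAbsConvex_polar (topDualPairing 𝕜 E) H) fun B hB =>
    absorbs_polar_of_isVonNBounded hH (hbdd B hB)

theorem isOpenMap_evalBidual_of_CNC [IsTopologicalAddGroup E] [LocallyConvexSpace ℝ E]
    (hτ : @IsTopologicalAddGroup E τ _) (hCNC : CNC 𝕜 τ γ)
    (hbdd : ∀ B, IsBdd 𝕜 γ B → IsBdd 𝕜 τ B) (hsr : IsSemiReflexive 𝕜 E) :
    @IsOpenMap E _ τ _ (evalBidual 𝕜 E) := by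
  have : ContinuousAdd (StrongDual 𝕜 (StrongDual 𝕜 E)) :=
    (inferInstance : IsTopologicalAddGroup (StrongDual 𝕜 (StrongDual 𝕜 E))).toContinuousAdd
  refine (@IsTopologicalAddGroup.isOpenMap_iff_nhds_zero E τ _ hτ _ _ _ _ _ _ _
    (evalBidual 𝕜 E)).2 ?_
  refine (hCNC.map _).ge_iff.2 ?_
  rintro U ⟨hU, habs, hclosed⟩
  have hpolar : IsVonNBounded 𝕜 (StrongDual.polar 𝕜 U) :=
    isVonNBounded_strongDual_polar fun B hB => hbdd B hB hU
  filter_upwards [hasBasis_nhds_zero_polar.mem_of_mem hpolar] with φ hφ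
  obtain ⟨x, rfl⟩ := hsr φ
  refine mem_image_of_mem _ ?_
  rw [id, ← polar_polar_eq_self 𝕜 habs hclosed ⟨0, @mem_of_mem_nhds E τ 0 U hU⟩]
  exact hφ

theorem isHomeomorph_evalBidual [IsTopologicalAddGroup E] [LocallyConvexSpace ℝ E] [T2Space E]
    (hτ : @IsTopologicalAddGroup E τ _) (hborn : IsBornological 𝕜 τ) (hCNC : CNC 𝕜 τ γ)
    (hbdd : SameBdd 𝕜 τ γ) (hsr : IsSemiReflexive 𝕜 E) :
    @IsHomeomorph E _ τ _ (evalBidual 𝕜 E) :=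
  @IsHomeomorph.mk E _ τ _ _
    (continuous_evalBidual_of_isBornological hτ hborn fun B => (hbdd B).1)
    (isOpenMap_evalBidual_of_CNC hτ hCNC (fun B => (hbdd B).2) hsr)
    ⟨evalBidual_injective, hsr⟩

end SecondTopology

section GammaTilde

variable {𝕜 X : Type*} [RCLike 𝕜] [AddCommGroup X] [Module 𝕜 X] [Module ℝ X]
  {τ τ' : TopologicalSpace X}

theorem CNC.mono {γ : TopologicalSpace X} (hγ : γ ≤ τ') (h : CNC 𝕜 τ τ') : CNC 𝕜 τ γ :=
  h.to_hasBasis (fun U hU => ⟨U, ⟨hU.1, hU.2.1, hU.2.2.mono hγ⟩, Subset.rfl⟩)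
    fun _ hU => h.mem_iff.1 hU.1

theorem gammaTilde_le (hτ' : IsLCH 𝕜 τ') : gammaTilde 𝕜 τ τ' ≤ τ' :=
  (isLeast_gammaTilde 𝕜 τ τ' hτ').2 ⟨hτ', fun _ _ => rfl⟩

theorem continuous_gammaTilde_of_continuousOn [IsScalarTower ℝ 𝕜 X] {F : Type*} [AddCommGroup F]
    [Module 𝕜 F] [Module ℝ F] [IsScalarTower ℝ 𝕜 F] [TopologicalSpace F] [IsTopologicalAddGroup F]
    [ContinuousSMul 𝕜 F] [LocallyConvexSpace ℝ F] (hτ' : IsLCH 𝕜 τ') {g : X →ₗ[𝕜] F}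
    (hg : ∀ B, IsBdd 𝕜 τ B → @ContinuousOn X F (gammaTilde 𝕜 τ τ') _ g B) :
    Continuous[gammaTilde 𝕜 τ τ', _] g := by
  obtain ⟨⟨hlch, hagree⟩, hleast⟩ := isLeast_gammaTilde 𝕜 τ τ' hτ'
  suffices h : gammaTilde 𝕜 τ τ' ⊓ .induced g inferInstance ∈
      {γ | IsLCH 𝕜 γ ∧ AgreeOnBdd 𝕜 τ τ' γ} from
    continuous_iff_le_induced.2 ((hleast h).trans inf_le_right)
  refine ⟨⟨?_, ?_, ?_, ?_⟩, fun B hB => ?_⟩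
  · exact topologicalAddGroup_inf hlch.1 (topologicalAddGroup_induced g)
  · exact @continuousSMul_inf _ _ _ _ _ _ hlch.2 (continuousSMul_induced g)
  · exact .inf hlch.3 (.induced (g.restrictScalars ℝ))
  · exact t2Space_antitone inf_le_left hlch.4
  · rw [← hagree B hB, induced_inf, inf_eq_left, induced_compose, ← continuous_iff_le_induced]
    exact (@continuousOn_iff_continuous_domRestrict X F (gammaTilde 𝕜 τ τ') _ g B).1 (hg B hB)

theorem completeSpace_strongDual_gammaTilde [IsScalarTower ℝ 𝕜 X] (hτ' : IsLCH 𝕜 τ')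
    (hbdd : ∀ B, IsBdd 𝕜 τ B → IsBdd 𝕜 (gammaTilde 𝕜 τ τ') B) :
    CompleteSpace (StrongDual 𝕜 (SpaceWith X (gammaTilde 𝕜 τ τ'))) :=
  completeSpace_uniformConvergenceCLM sUnion_isVonNBounded_eq_univ fun _ hg =>
    continuous_gammaTilde_of_continuousOn hτ' fun B hB => hg B (hbdd B hB)

theorem isHomeomorph_evalMixed [IsScalarTower ℝ 𝕜 X] (hτ : @IsTopologicalAddGroup X τ _)
    (hτ' : IsLCH 𝕜 τ') (hborn : IsBornological 𝕜 τ) (hCNC : CNC 𝕜 τ τ')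
    (hbdd : SameBdd 𝕜 τ (gammaTilde 𝕜 τ τ'))
    (hsr : IsSemiReflexive 𝕜 (SpaceWith X (gammaTilde 𝕜 τ τ'))) :
    IsHomeomorph (evalMixed 𝕜 τ τ') := by
  have hlch := (isLeast_gammaTilde 𝕜 τ τ' hτ').1.1
  have : IsTopologicalAddGroup (SpaceWith X (gammaTilde 𝕜 τ τ')) := hlch.1
  have : LocallyConvexSpace ℝ (SpaceWith X (gammaTilde 𝕜 τ τ')) := hlch.3
  have : T2Space (SpaceWith X (gammaTilde 𝕜 τ τ')) := hlch.4
  have : IsScalarTower ℝ 𝕜 (SpaceWith X (gammaTilde 𝕜 τ τ')) := ‹IsScalarTower ℝ 𝕜 X›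
  have heval := isHomeomorph_evalBidual (𝕜 := 𝕜) (E := SpaceWith X (gammaTilde 𝕜 τ τ')) hτ hborn
    (hCNC.mono (gammaTilde_le hτ')) hbdd hsr
  exact heval

end GammaTilde

end MixedDual

theorem mainTheorem12 {𝕜 : Type*} [RCLike 𝕜] {X : Type*} [AddCommGroup X] [Module 𝕜 X]
    [Module ℝ X] [IsScalarTower ℝ 𝕜 X] (τ τ' : TopologicalSpace X)
    (hτ : MixedDual.IsLCH 𝕜 τ) (hτ' : MixedDual.IsLCH 𝕜 τ')
    (hborn : MixedDual.IsBornological 𝕜 τ)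
    (hBBCl : MixedDual.BBCl 𝕜 τ τ') (hCNC : MixedDual.CNC 𝕜 τ τ')
    (hsr : MixedDual.IsSemiReflexive 𝕜
      (MixedDual.SpaceWith X (MixedDual.gammaTilde 𝕜 τ τ')))
    (hbdd : MixedDual.SameBdd 𝕜 τ (MixedDual.gammaTilde 𝕜 τ τ')) :
    (CompleteSpace (StrongDual 𝕜 (MixedDual.SpaceWith X (MixedDual.gammaTilde 𝕜 τ τ'))) ∧
      BarrelledSpace 𝕜 (StrongDual 𝕜 (MixedDual.SpaceWith X (MixedDual.gammaTilde 𝕜 τ τ'))) ∧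
      MixedDual.IsLCH 𝕜 (inferInstance : TopologicalSpace
        (StrongDual 𝕜 (MixedDual.SpaceWith X (MixedDual.gammaTilde 𝕜 τ τ'))))) ∧
    IsHomeomorph (MixedDual.evalMixed 𝕜 τ τ') ∧
    MixedDual.IsPrebidual 𝕜 τ (MixedDual.gammaTilde 𝕜 τ τ') (MixedDual.evalMixed 𝕜 τ τ') ∧
    MixedDual.IsSemiReflexive 𝕜
      (MixedDual.SpaceWith X (MixedDual.gammaTilde 𝕜 τ τ')) := by
  have hlch := (MixedDual.isLeast_gammaTilde 𝕜 τ τ' hτ').1.1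
  have : IsTopologicalAddGroup (MixedDual.SpaceWith X (MixedDual.gammaTilde 𝕜 τ τ')) := hlch.1
  have : LocallyConvexSpace ℝ (MixedDual.SpaceWith X (MixedDual.gammaTilde 𝕜 τ τ')) := hlch.3
  have : IsScalarTower ℝ 𝕜 (MixedDual.SpaceWith X (MixedDual.gammaTilde 𝕜 τ τ')) :=
    ‹IsScalarTower ℝ 𝕜 X›
  have hhomeo : IsHomeomorph (MixedDual.evalMixed 𝕜 τ τ') :=
    MixedDual.isHomeomorph_evalMixed hτ.1 hτ' hborn hCNC hbdd hsr
  refine ⟨⟨?_, hsr.barrelledSpace_strongDual, ?_⟩, hhomeo, ⟨hlch, hhomeo⟩, hsr⟩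
  · exact MixedDual.completeSpace_strongDual_gammaTilde hτ' fun B => (hbdd B).1
  · exact ⟨inferInstance, inferInstance, inferInstance, inferInstance⟩
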